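/- Let $\mathbb F$ be a field, let $\mathcal A$ be a finite-dimensional (not necessarily associative or unital) $\mathbb F$-algebra, let $G$ be an abelian group, and let $\Gamma:\mathcal A=\bigoplus_{g\in G}\mathcal A_g$ be a $G$-grading, i.e. a vector space decomposition with $\mathcal A_g\mathcal A_h\subseteq\mathcal A_{gh}$, with support $\operatorname{supp}\Gamma=\{g\in G:\mathcal A_g\neq0\}$. Group schemes are regarded as functors from commutative $\mathbb F$-algebras to groups. Let $\mathbf{Stab}(\Gamma)(R)$ be the group of automorphisms $\varphi$ of the $R$-algebra $\mathcal A\otimes R$ with $\varphi(\mathcal A_g\otimes R)=\mathcal A_g\otimes R$ for all $g\in G$. Let $\mathbf{Aut}(\Gamma)(R)$ be the group of automorphisms $\varphi$ of the $R$-algebra $\mathcal A\otimes R$ for which there are nonzero orthogonal idempotents $e_1,\dots,e_n\in R$ with $e_1+\dots+e_n=1$ and permutations $\sigma_1,\dots,\sigma_n$ of $\operatorname{supp}\Gamma$ such that $\varphi(\mathcal A_s\otimes Re_i)=\mathcal A_{\sigma_i(s)}\otimes Re_i$ for all $i$ and all $s\in\operatorname{supp}\Gamma$. For a finite group $W$,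 the constant group scheme of $W$ sends $R$ to the group of locally constant functions $\operatorname{Spec}R\to W$ (the group $W$ itself if $R\ne 0$ has no proper idempotents). Sending $\varphi$ as above to the function with value $\sigma_i$ on the open and closed subset $\{P: e_i\notin P\}$ of $\operatorname{Spec}R$ defines a natural morphism $\mathbf{Aut}(\Gamma)\to\mathsf{Sym}(\operatorname{supp}\Gamma)$ to the constant group scheme of the symmetric group of $\operatorname{supp}\Gamma$. Its image, i.e. the smallest closed subgroup scheme of $\mathsf{Sym}(\operatorname{supp}\Gamma)$ through which it factors, is the Weyl group scheme $\mathsf W(\Gamma)$. Let $\overline{\mathbb F}$ be an algebraic closure of $\mathbb F$, and let $\Gamma_{\overline{\mathbb F}}$ be the grading on $\mathcal A\otimes\overline{\mathbb F}$ with components $\mathcal A_g\otimes\overline{\mathbb F}$; its support is $\operatorname{supp}\Gamma$. Its ordinary Weyl group is $W(\Gamma_{\overline{\mathbb F}})=\operatorname{Aut}(\Gamma_{\overline{\mathbb F}})/\operatorname{Stab}(\Gamma_{\overline{\mathbb F}})$, where $\operatorname{Aut}(\Gamma_{\overline{\mathbb F}})$ is the group of automorphisms of the $\overline{\mathbb F}$-algebra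 $\mathcal A\otimes\overline{\mathbb F}$ that map every component into some component, and $\operatorname{Stab}(\Gamma_{\overline{\mathbb F}})$ is the subgroup of those that map every component into itself. The group $W(\Gamma_{\overline{\mathbb F}})$ acts faithfully on $\operatorname{supp}\Gamma$. Then $\mathsf W(\Gamma)$ is isomorphic to the constant group scheme associated to $W(\Gamma_{\overline{\mathbb F}})$, by an isomorphism compatible with the inclusion $\mathsf W(\Gamma)\hookrightarrow\mathsf{Sym}(\operatorname{supp}\Gamma)$ and the morphism to $\mathsf{Sym}(\operatorname{supp}\Gamma)$ induced by the embedding $W(\Gamma_{\overline{\mathbb F}})\hookrightarrow\operatorname{Sym}(\operatorname{supp}\Gamma)$. Moreover, the sequence of groups $$1\to\mathbf{Stab}(\Gamma)(\overline{\mathbb F})\to\mathbf{Aut}(\Gamma)(\overline{\mathbb F})\to\mathsf W(\Gamma)(\overline{\mathbb F})\to1$$ is exact. -/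

import Mathlib

open CategoryTheory
open scoped TensorProduct

universe u

namespace GradingScheme

/-! ## Group functors on commutative algebras -/

section GroupFunctors

variable {F : Type u} [Field F]

/-- A subgroup functor of a group-valued functor on commutative `F`-algebras. -/
structure SubgroupFunctor (Y : CommAlgCat.{u} F ⥤ GrpCat.{u}) where
  obj : ∀ R : CommAlgCat.{u} F, Subgroup (Y.obj R)
  map_mem : ∀ {R S : CommAlgCat.{u} F} (f : R ⟶ S) {y : Y.obj R}, y ∈ obj R → Y.map f y ∈ obj S

namespace SubgroupFunctor

variable {Y : CommAlgCat.{u} F ⥤ GrpCat.{u}}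

/-- A subgroup functor, regarded as a group-valued functor. -/
def toFunctor (H : SubgroupFunctor Y) : CommAlgCat.{u} F ⥤ GrpCat.{u} where
  obj R := GrpCat.of (H.obj R)
  map {R S} f := GrpCat.ofHom
    (((Y.map f).hom.comp (H.obj R).subtype).codRestrict (H.obj S) fun y => H.map_mem f y.2)
  map_id R := by
    ext y
    change Y.map (𝟙 R) y.1 = y.1
    simp
  map_comp {R S T} f g := by
    ext y
    change Y.map (f ≫ g) y.1 = Y.map g (Y.map f y.1)
    simp

/-- The inclusion of a subgroup functor. -/
def ι (H : SubgroupFunctor Y) : H.toFunctor ⟶ Y where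
  app R := GrpCat.ofHom (H.obj R).subtype
  naturality _ _ _ := rfl

/-- The intersection of two subgroup functors. -/
def inter (H H' : SubgroupFunctor Y) : SubgroupFunctor Y where
  obj R := H.obj R ⊓ H'.obj R
  map_mem f _ hy := ⟨H.map_mem f hy.1, H'.map_mem f hy.2⟩

/-- A subgroup functor `H` of `Y` is closed if for every point `y ∈ Y(R)` the condition
"`y` lies in `H`" is cut out by an ideal `I` of `R`: for `f : R → S`, the image of `y` in `Y(S)`
lies in `H(S)` if and only if `f` kills `I`. When `Y` is represented by an algebra `B`, this says
that `H` is the subfunctor represented by a quotient `B ⧸ J`, that is, a closed subgroup scheme. -/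
def IsClosed (H : SubgroupFunctor Y) : Prop :=
  ∀ (R : CommAlgCat.{u} F) (y : Y.obj R), ∃ I : Ideal R, ∀ (S : CommAlgCat.{u} F) (f : R ⟶ S),
    Y.map f y ∈ H.obj S ↔ I ≤ RingHom.ker f.hom

end SubgroupFunctor

variable {X Y : CommAlgCat.{u} F ⥤ GrpCat.{u}}

/-- The morphism `θ` factors through the subgroup functor `H` of its target. -/
def FactorsThrough (θ : X ⟶ Y) (H : SubgroupFunctor Y) : Prop :=
  ∀ (R : CommAlgCat.{u} F) (x : X.obj R), θ.app R x ∈ H.obj R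

/-- The image of a morphism of group schemes: the smallest closed subgroup functor of the target
through which the morphism factors, i.e. the intersection of all of them. -/
def image (θ : X ⟶ Y) : SubgroupFunctor Y where
  obj R := ⨅ H : {H : SubgroupFunctor Y // H.IsClosed ∧ FactorsThrough θ H}, H.1.obj R
  map_mem f y hy := by
    rw [Subgroup.mem_iInf] at hy ⊢
    exact fun H => H.1.map_mem f (hy H)

theorem image_factorsThrough (θ : X ⟶ Y) : FactorsThrough θ (image θ) := fun R x =>
  Subgroup.mem_iInf.2 fun H => H.2.2 R x

theorem image_isClosed (θ : X ⟶ Y) : (image θ).IsClosed := by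
  intro R y
  choose I hI using fun H : {H : SubgroupFunctor Y // H.IsClosed ∧ FactorsThrough θ H} => H.2.1 R y
  refine ⟨⨆ H, I H, fun S f => ?_⟩
  rw [iSup_le_iff]
  exact Subgroup.mem_iInf.trans (forall_congr' fun H => hI H S f)

theorem image_le (θ : X ⟶ Y) (H : SubgroupFunctor Y) (hc : H.IsClosed) (hf : FactorsThrough θ H)
    (R : CommAlgCat.{u} F) : (image θ).obj R ≤ H.obj R :=
  iInf_le (fun H : {H : SubgroupFunctor Y // H.IsClosed ∧ FactorsThrough θ H} => H.1.obj R)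
    ⟨H, hc, hf⟩

/-- The morphism onto the image. -/
def toImage (θ : X ⟶ Y) : X ⟶ (image θ).toFunctor where
  app R := GrpCat.ofHom ((θ.app R).hom.codRestrict ((image θ).obj R) (image_factorsThrough θ R))
  naturality R S f := by
    ext x
    apply Subtype.ext
    exact congrArg (fun g => g.hom x) (θ.naturality f)

end GroupFunctors

/-! ## Constant group schemes -/

section Constant

variable (F : Type u) [Field F]

/-- Pull-back of locally constant functions along `Spec S → Spec R`. -/
noncomputable def comapLocallyConstant (W : Type u) [Group W] {R S : CommAlgCat.{u} F} (f : R ⟶ S) :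
    LocallyConstant (PrimeSpectrum R) W →* LocallyConstant (PrimeSpectrum S) W where
  toFun c := c.comap ⟨PrimeSpectrum.comap f.hom.toRingHom, PrimeSpectrum.continuous_comap _⟩
  map_one' := rfl
  map_mul' _ _ := rfl

/-- The constant group scheme associated to a group `W`: it sends `R` to the group of locally
constant functions `Spec R → W`. If `R` is nonzero without proper idempotents, then `Spec R` is
connected and this is the group `W` itself; if `W` is finite, it is represented by the algebra of
functions `W → F`. -/
noncomputable def constantGroupScheme (W : Type u) [Group W] :
    CommAlgCat.{u} F ⥤ GrpCat.{u} where
  obj R := GrpCat.of (LocallyConstant (PrimeSpectrum R) W)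
  map f := GrpCat.ofHom (comapLocallyConstant F W f)
  map_id _ := rfl
  map_comp _ _ := rfl

/-- The morphism of constant group schemes induced by a group homomorphism. -/
noncomputable def constantGroupSchemeMap {W W' : Type u} [Group W] [Group W'] (h : W →* W') :
    constantGroupScheme F W ⟶ constantGroupScheme F W' where
  app R := GrpCat.ofHom
    { toFun := fun c => LocallyConstant.map h c
      map_one' := by ext; exact h.map_one
      map_mul' := fun _ _ => by ext; exact h.map_mul _ _ }
  naturality _ _ _ := rfl

end Constant

/-! ## Linear automorphisms of scalar extensions -/

section GeneralLinear

variable {F : Type u} [Field F] {V : Type u} [AddCommGroup V] [Module F V]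
variable {R S T : Type u} [CommRing R] [Algebra F R] [CommRing S] [Algebra F S]
  [CommRing T] [Algebra F T]

/-- The map `f ⊗ id : R ⊗ V → S ⊗ V` for a homomorphism `f : R → S`. -/
noncomputable def extMap (V : Type u) [AddCommGroup V] [Module F V] (f : R →ₐ[F] S) :
    R ⊗[F] V →ₗ[F] S ⊗[F] V :=
  LinearMap.rTensor V f.toLinearMap

@[simp]
theorem extMap_tmul (f : R →ₐ[F] S) (r : R) (v : V) :
    extMap V f (r ⊗ₜ[F] v) = f r ⊗ₜ[F] v := rfl

theorem extMap_smul (f : R →ₐ[F] S) (r : R) (x : R ⊗[F] V) :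
    extMap V f (r • x) = f r • extMap V f x := by
  induction x using TensorProduct.induction_on with
  | zero => simp
  | tmul a v => simp [TensorProduct.smul_tmul']
  | add x y hx hy => simp only [smul_add, map_add, hx, hy]

/-- Scalar extension along `f : R → S` of an `R`-linear endomorphism of `R ⊗ V`. -/
noncomputable def endMap (f : R →ₐ[F] S) (φ : R ⊗[F] V →ₗ[R] R ⊗[F] V) :
    S ⊗[F] V →ₗ[S] S ⊗[F] V :=
  LinearMap.liftBaseChange S
    (extMap V f ∘ₗ φ.restrictScalars F ∘ₗ TensorProduct.mk F R V 1)

theorem endMap_extMap (f : R →ₐ[F] S) (φ : R ⊗[F] V →ₗ[R] R ⊗[F] V) (x : R ⊗[F] V) :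
    endMap f φ (extMap V f x) = extMap V f (φ x) := by
  induction x using TensorProduct.induction_on with
  | zero => simp
  | tmul a v =>
    have h : a ⊗ₜ[F] v = a • ((1 : R) ⊗ₜ[F] v) := by simp [TensorProduct.smul_tmul']
    rw [h, extMap_smul, (endMap f φ).map_smul, φ.map_smul, extMap_smul]
    simp [endMap]
  | add x y hx hy => simp only [map_add, hx, hy]

theorem end_ext (f : R →ₐ[F] S) {φ ψ : S ⊗[F] V →ₗ[S] S ⊗[F] V}
    (h : ∀ x : R ⊗[F] V, φ (extMap V f x) = ψ (extMap V f x)) : φ = ψ := by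
  apply TensorProduct.AlgebraTensorModule.curry_injective
  ext v
  simpa using h ((1 : R) ⊗ₜ[F] v)

theorem endMap_id (f : R →ₐ[F] S) :
    endMap f (LinearMap.id : R ⊗[F] V →ₗ[R] R ⊗[F] V) = LinearMap.id :=
  end_ext f fun x => by rw [endMap_extMap]; rfl

theorem endMap_comp (f : R →ₐ[F] S) (φ ψ : R ⊗[F] V →ₗ[R] R ⊗[F] V) :
    endMap f (φ ∘ₗ ψ) = endMap f φ ∘ₗ endMap f ψ :=
  end_ext f fun x => by
    simp only [endMap_extMap, LinearMap.comp_apply]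

/-- Scalar extension along `f : R → S` of `R`-linear automorphisms of `R ⊗ V`. -/
noncomputable def glMap (f : R →ₐ[F] S) :
    ((R ⊗[F] V) ≃ₗ[R] (R ⊗[F] V)) →* ((S ⊗[F] V) ≃ₗ[S] (S ⊗[F] V)) where
  toFun φ := LinearEquiv.ofLinearMap (endMap f φ.toLinearMap) (endMap f φ.symm.toLinearMap)
    (by rw [← endMap_comp, LinearEquiv.comp_coe, LinearEquiv.symm_trans_self]; exact endMap_id f)
    (by rw [← endMap_comp, LinearEquiv.comp_coe, LinearEquiv.self_trans_symm]; exact endMap_id f)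
  map_one' := by
    apply LinearEquiv.toLinearMap_injective
    exact endMap_id f
  map_mul' φ ψ := by
    apply LinearEquiv.toLinearMap_injective
    exact endMap_comp f φ.toLinearMap ψ.toLinearMap

theorem glMap_extMap (f : R →ₐ[F] S) (φ : (R ⊗[F] V) ≃ₗ[R] (R ⊗[F] V)) (x : R ⊗[F] V) :
    glMap f φ (extMap V f x) = extMap V f (φ x) :=
  endMap_extMap f φ.toLinearMap x

theorem gl_ext (f : R →ₐ[F] S) {φ ψ : (S ⊗[F] V) ≃ₗ[S] (S ⊗[F] V)}
    (h : ∀ x : R ⊗[F] V, φ (extMap V f x) = ψ (extMap V f x)) : φ = ψ :=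
  LinearEquiv.toLinearMap_injective (end_ext f h)

theorem extMap_id (x : R ⊗[F] V) : extMap V (AlgHom.id F R) x = x :=
  LinearMap.congr_fun (LinearMap.rTensor_id V R) x

theorem extMap_comp (f : R →ₐ[F] S) (g : S →ₐ[F] T) (x : R ⊗[F] V) :
    extMap V (g.comp f) x = extMap V g (extMap V f x) :=
  LinearMap.congr_fun (LinearMap.rTensor_comp V g.toLinearMap f.toLinearMap) x

theorem glMap_id (φ : (R ⊗[F] V) ≃ₗ[R] (R ⊗[F] V)) : glMap (AlgHom.id F R) φ = φ :=
  gl_ext (AlgHom.id F R) fun x => by rw [glMap_extMap, extMap_id, extMap_id]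

theorem glMap_comp (f : R →ₐ[F] S) (g : S →ₐ[F] T) (φ : (R ⊗[F] V) ≃ₗ[R] (R ⊗[F] V)) :
    glMap (g.comp f) φ = glMap g (glMap f φ) :=
  gl_ext (g.comp f) fun x => by
    rw [glMap_extMap, extMap_comp, extMap_comp, glMap_extMap, glMap_extMap]

variable (F V) in
/-- The general linear group functor `R ↦ Aut_R(R ⊗ V)`. -/
noncomputable def glFunctor : CommAlgCat.{u} F ⥤ GrpCat.{u} where
  obj R := GrpCat.of ((R ⊗[F] V) ≃ₗ[R] (R ⊗[F] V))
  map f := GrpCat.ofHom (glMap f.hom)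
  map_id R := by
    ext φ
    exact LinearEquiv.congr_fun (glMap_id φ) _
  map_comp {R S T} f g := by
    ext φ
    exact LinearEquiv.congr_fun (glMap_comp f.hom g.hom φ) _

end GeneralLinear

/-! ## Automorphism schemes of decompositions and of algebras -/

section Decompositions

variable {F : Type u} [Field F] {V : Type u} [AddCommGroup V] [Module F V] {I : Type u}

/-- The support of a family of subspaces: the set of indices of its nonzero members. -/
def support (𝒱 : I → Submodule F V) : Set I := {s | 𝒱 s ≠ ⊥}

variable {R S : Type u} [CommRing R] [Algebra F R] [CommRing S] [Algebra F S]

variable (R) in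
/-- The submodule `Re ⊗ N` of `R ⊗ V`, for a subspace `N` of `V` and an element `e` of `R`. -/
noncomputable def piece (N : Submodule F V) (e : R) : Submodule R (R ⊗[F] V) :=
  (N.baseChange R).map (LinearMap.lsmul R (R ⊗[F] V) e)

theorem piece_mul (N : Submodule F V) (d e : R) :
    piece R N (d * e) = (piece R N e).map (LinearMap.lsmul R (R ⊗[F] V) d) := by
  rw [piece, piece, ← Submodule.map_comp]
  congr 1
  exact LinearMap.ext fun x => mul_smul d e x

theorem piece_eq_span (N : Submodule F V) (e : R) :
    piece R N e = Submodule.span R ((fun v => e ⊗ₜ[F] v) '' (N : Set V)) := by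
  rw [piece, Submodule.baseChange_eq_span, Submodule.map_span]
  congr 1
  ext x
  simp [TensorProduct.smul_tmul']

theorem piece_map (f : R →ₐ[F] S) (N : Submodule F V) (e : R) :
    piece S N (f e) = Submodule.span S (extMap V f '' (piece R N e : Set (R ⊗[F] V))) := by
  apply le_antisymm
  · rw [piece_eq_span, Submodule.span_le]
    rintro _ ⟨v, hv, rfl⟩
    refine Submodule.subset_span ⟨e ⊗ₜ v, ?_, rfl⟩
    rw [piece_eq_span]
    exact Submodule.subset_span ⟨v, hv, rfl⟩
  · rw [Submodule.span_le]
    rintro _ ⟨x, hx, rfl⟩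
    rw [piece_eq_span] at hx
    induction hx using Submodule.span_induction with
    | mem x hx =>
      obtain ⟨v, hv, rfl⟩ := hx
      rw [piece_eq_span]
      exact Submodule.subset_span ⟨v, hv, rfl⟩
    | zero => simp
    | add x y _ _ hx hy => rw [map_add]; exact add_mem hx hy
    | smul r x _ hx => rw [extMap_smul]; exact Submodule.smul_mem _ _ hx

/-- The automorphism `φ` of `R ⊗ V` maps `Re ⊗ V_s` onto `Re ⊗ V_{σ(s)}` for all `s` in the
support. -/
def Permutes (𝒱 : I → Submodule F V) (φ : (R ⊗[F] V) ≃ₗ[R] (R ⊗[F] V)) (e : R)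
    (σ : Equiv.Perm (support 𝒱)) : Prop :=
  ∀ s : support 𝒱, (piece R (𝒱 s) e).map φ.toLinearMap = piece R (𝒱 (σ s)) e

variable {𝒱 : I → Submodule F V} {φ ψ : (R ⊗[F] V) ≃ₗ[R] (R ⊗[F] V)} {d e : R}
  {σ τ : Equiv.Perm (support 𝒱)}

theorem Permutes.mul_left (h : Permutes 𝒱 φ e σ) (d : R) : Permutes 𝒱 φ (d * e) σ := by
  intro s
  rw [piece_mul, piece_mul, ← h s, ← Submodule.map_comp, ← Submodule.map_comp]
  congr 1
  ext x
  simp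

theorem Permutes.one (e : R) : Permutes 𝒱 1 e 1 := fun _ => Submodule.map_id _

theorem Permutes.mul (h : Permutes 𝒱 φ e σ) (h' : Permutes 𝒱 ψ e τ) :
    Permutes 𝒱 (φ * ψ) e (σ * τ) := by
  intro s
  have : (φ * ψ).toLinearMap = φ.toLinearMap ∘ₗ ψ.toLinearMap := rfl
  rw [this, Submodule.map_comp, h' s, h (τ s)]
  rfl

theorem Permutes.inv (h : Permutes 𝒱 φ e σ) : Permutes 𝒱 φ⁻¹ e σ⁻¹ := by
  intro s
  have h1 := h (σ⁻¹ s)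
  rw [show σ (σ⁻¹ s) = s from σ.apply_symm_apply s] at h1
  rw [← h1, ← Submodule.map_comp]
  have : φ⁻¹.toLinearMap ∘ₗ φ.toLinearMap = LinearMap.id := by
    ext x; exact φ.symm_apply_apply _
  rw [this, Submodule.map_id]

theorem Permutes.glMap (h : Permutes 𝒱 φ e σ) (f : R →ₐ[F] S) :
    Permutes 𝒱 (glMap f φ) (f e) σ := by
  intro s
  rw [piece_map, piece_map, Submodule.map_span, ← h s, Submodule.map_coe]
  congr 1
  rw [Set.image_image, Set.image_image]
  exact Set.image_congr fun x _ => glMap_extMap f φ x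

/-- The condition that defines the `R`-points of the automorphism scheme of a decomposition. -/
def LocallyPermutes (𝒱 : I → Submodule F V) (φ : (R ⊗[F] V) ≃ₗ[R] (R ⊗[F] V)) : Prop :=
  ∃ (n : ℕ) (e : Fin n → R) (σ : Fin n → Equiv.Perm (support 𝒱)),
    CompleteOrthogonalIdempotents e ∧ (∀ i, e i ≠ 0) ∧ ∀ i, Permutes 𝒱 φ (e i) (σ i)

theorem LocallyPermutes.of_fintype {κ : Type*} [Fintype κ] (e : κ → R)
    (σ : κ → Equiv.Perm (support 𝒱)) (he : CompleteOrthogonalIdempotents e)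
    (h : ∀ i, Permutes 𝒱 φ (e i) (σ i)) : LocallyPermutes 𝒱 φ := by
  classical
  let α := {i : κ // e i ≠ 0}
  let q : Fin (Fintype.card α) ≃ α := (Fintype.equivFin α).symm
  refine ⟨Fintype.card α, fun i => e (q i).1, fun i => σ (q i).1, ?_, fun i => (q i).2,
    fun i => h _⟩
  rw [CompleteOrthogonalIdempotents.iff_ortho_complete] at he ⊢
  refine ⟨fun i j hij => he.1 fun hh => hij (q.injective (Subtype.ext hh)), ?_⟩
  rw [← he.2, q.sum_comp (fun i : α => e i.1), ← Finset.sum_filter_ne_zero (s := Finset.univ) (f := e)]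
  exact (Finset.sum_subtype (p := fun i => e i ≠ 0) _ (fun i => by simp) e).symm

theorem LocallyPermutes.one : LocallyPermutes 𝒱 (1 : (R ⊗[F] V) ≃ₗ[R] (R ⊗[F] V)) :=
  LocallyPermutes.of_fintype (fun _ : Unit => (1 : R)) (fun _ => 1)
    (by rw [CompleteOrthogonalIdempotents.iff_ortho_complete]
        exact ⟨fun i j hij => (hij (Subsingleton.elim i j)).elim, by simp⟩)
    fun _ => Permutes.one _

theorem LocallyPermutes.mul (hφ : LocallyPermutes 𝒱 φ) (hψ : LocallyPermutes 𝒱 ψ) :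
    LocallyPermutes 𝒱 (φ * ψ) := by
  obtain ⟨m, d, σ, hd, -, h⟩ := hφ
  obtain ⟨n, e, τ, he, -, h'⟩ := hψ
  rw [CompleteOrthogonalIdempotents.iff_ortho_complete] at hd he
  refine LocallyPermutes.of_fintype (fun p : Fin m × Fin n => d p.1 * e p.2)
    (fun p => σ p.1 * τ p.2) ?_ fun p => Permutes.mul ?_ ((h' p.2).mul_left _)
  · rw [CompleteOrthogonalIdempotents.iff_ortho_complete]
    constructor
    · rintro ⟨i, j⟩ ⟨k, l⟩ hne
      by_cases hik : i = k
      · have hjl : j ≠ l := fun hjl => hne (by rw [hik, hjl])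
        have h0 : e j * e l = 0 := he.1 hjl
        linear_combination d i * d k * h0
      · have h0 : d i * d k = 0 := hd.1 hik
        linear_combination e j * e l * h0
    · rw [Fintype.sum_prod_type, ← Fintype.sum_mul_sum, hd.2, he.2, one_mul]
  · rw [mul_comm]
    exact (h p.1).mul_left _

theorem LocallyPermutes.inv (hφ : LocallyPermutes 𝒱 φ) : LocallyPermutes 𝒱 φ⁻¹ := by
  obtain ⟨n, e, σ, he, -, h⟩ := hφ
  exact LocallyPermutes.of_fintype e (fun i => (σ i)⁻¹) he fun i => (h i).inv

theorem LocallyPermutes.glMap (hφ : LocallyPermutes 𝒱 φ) (f : R →ₐ[F] S) :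
    LocallyPermutes 𝒱 (glMap f φ) := by
  obtain ⟨n, e, σ, he, -, h⟩ := hφ
  refine LocallyPermutes.of_fintype (fun i => f (e i)) σ ?_ fun i => (h i).glMap f
  rw [CompleteOrthogonalIdempotents.iff_ortho_complete] at he ⊢
  refine ⟨fun i j hij => ?_, ?_⟩
  · have h0 : e i * e j = 0 := he.1 hij
    change f (e i) * f (e j) = 0
    rw [← map_mul, h0, map_zero]
  · rw [← map_sum, he.2, map_one]

variable (𝒱) in
/-- The group scheme `GL(V, Γ)` of a decomposition `Γ : V = ⨁ V_s`: its `R`-points are the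
automorphisms `φ` of `R ⊗ V` for which there are nonzero orthogonal idempotents `e₁, …, eₙ` of `R`
with sum `1` and permutations `σ₁, …, σₙ` of the support such that `φ` maps `Reᵢ ⊗ V_s` onto
`Reᵢ ⊗ V_{σᵢ(s)}`. -/
noncomputable def glDecomposition : SubgroupFunctor (glFunctor F V) where
  obj R :=
    { carrier := {φ : (R ⊗[F] V) ≃ₗ[R] (R ⊗[F] V) | LocallyPermutes 𝒱 φ}
      one_mem' := LocallyPermutes.one
      mul_mem' := LocallyPermutes.mul
      inv_mem' := LocallyPermutes.inv }
  map_mem f _ h := LocallyPermutes.glMap h f.hom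

/-- The automorphism `φ` of `R ⊗ V` maps each `R ⊗ V_s` onto itself. -/
def Stabilizes (𝒱 : I → Submodule F V) (φ : (R ⊗[F] V) ≃ₗ[R] (R ⊗[F] V)) : Prop :=
  ∀ s, ((𝒱 s).baseChange R).map φ.toLinearMap = (𝒱 s).baseChange R

theorem Stabilizes.mul (h : Stabilizes 𝒱 φ) (h' : Stabilizes 𝒱 ψ) : Stabilizes 𝒱 (φ * ψ) := by
  intro s
  have : (φ * ψ).toLinearMap = φ.toLinearMap ∘ₗ ψ.toLinearMap := rfl
  rw [this, Submodule.map_comp, h' s, h s]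

theorem Stabilizes.inv (h : Stabilizes 𝒱 φ) : Stabilizes 𝒱 φ⁻¹ := by
  intro s
  have : φ⁻¹.toLinearMap ∘ₗ φ.toLinearMap = LinearMap.id := by
    ext x; exact φ.symm_apply_apply _
  conv_lhs => rw [← h s]
  rw [← Submodule.map_comp, this, Submodule.map_id]

theorem piece_one (N : Submodule F V) : piece R N 1 = N.baseChange R := by
  have : LinearMap.lsmul R (R ⊗[F] V) 1 = LinearMap.id := LinearMap.ext fun x => one_smul R x
  rw [piece, this, Submodule.map_id]

theorem LocallyPermutes.of_stabilizes (h : Stabilizes 𝒱 φ) : LocallyPermutes 𝒱 φ :=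
  LocallyPermutes.of_fintype (fun _ : Unit => (1 : R)) (fun _ => 1)
    (by rw [CompleteOrthogonalIdempotents.iff_ortho_complete]
        exact ⟨fun i j hij => (hij (Subsingleton.elim i j)).elim, by simp⟩)
    fun _ s => by rw [piece_one, h s, Equiv.Perm.one_apply, piece_one]

theorem Stabilizes.glMap (h : Stabilizes 𝒱 φ) (f : R →ₐ[F] S) : Stabilizes 𝒱 (glMap f φ) := by
  intro s
  have h1 := h s
  rw [← piece_one] at h1 ⊢
  rw [← map_one f, piece_map, Submodule.map_span]
  congr 1
  conv_rhs => rw [← h1]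
  rw [Submodule.map_coe, Set.image_image, Set.image_image]
  exact Set.image_congr fun x _ => glMap_extMap f φ x

variable (𝒱) in
/-- The stabilizer of a decomposition: the automorphisms of `R ⊗ V` that map each `R ⊗ V_s` onto
itself. -/
noncomputable def stabDecomposition : SubgroupFunctor (glFunctor F V) where
  obj R :=
    { carrier := {φ : (R ⊗[F] V) ≃ₗ[R] (R ⊗[F] V) | Stabilizes 𝒱 φ}
      one_mem' := fun _ => Submodule.map_id _
      mul_mem' := Stabilizes.mul
      inv_mem' := Stabilizes.inv }
  map_mem f _ h := Stabilizes.glMap h f.hom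

end Decompositions

section AutAlgebra

variable {F : Type u} [Field F] {A : Type u} [NonUnitalNonAssocRing A] [Module F A]
  [IsScalarTower F A A] [SMulCommClass F A A]

theorem extMap_mul {R S : Type u} [CommRing R] [Algebra F R] [CommRing S] [Algebra F S]
    (f : R →ₐ[F] S) (x y : R ⊗[F] A) :
    extMap A f (x * y) = extMap A f x * extMap A f y := by
  induction x using TensorProduct.induction_on with
  | zero => simp
  | add x x' hx hx' => simp only [add_mul, map_add, hx, hx']
  | tmul r a =>
    induction y using TensorProduct.induction_on with
    | zero => simp
    | add y y' hy hy' => simp only [mul_add, map_add, hy, hy']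
    | tmul s b => simp

theorem glMap_mul {R S : Type u} [CommRing R] [Algebra F R] [CommRing S] [Algebra F S]
    (f : R →ₐ[F] S) {φ : (R ⊗[F] A) ≃ₗ[R] (R ⊗[F] A)} (h : ∀ x y, φ (x * y) = φ x * φ y)
    (x y : S ⊗[F] A) : glMap f φ (x * y) = glMap f φ x * glMap f φ y := by
  have key : ∀ a b : A, glMap f φ ((1 : S) ⊗ₜ[F] a * (1 : S) ⊗ₜ[F] b) =
      glMap f φ ((1 : S) ⊗ₜ[F] a) * glMap f φ ((1 : S) ⊗ₜ[F] b) := by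
    intro a b
    have e : ∀ a : A, (1 : S) ⊗ₜ[F] a = extMap A f ((1 : R) ⊗ₜ[F] a) := fun a => by simp
    rw [e, e, ← extMap_mul, glMap_extMap, glMap_extMap, glMap_extMap, ← extMap_mul, h]
  induction x using TensorProduct.induction_on with
  | zero => simp
  | add x x' hx hx' => simp only [add_mul, map_add, hx, hx']
  | tmul r a =>
    induction y using TensorProduct.induction_on with
    | zero => simp
    | add y y' hy hy' => simp only [mul_add, map_add, hy, hy']
    | tmul s b =>
      have e : ∀ (r : S) (a : A), r ⊗ₜ[F] a = r • ((1 : S) ⊗ₜ[F] a) := fun r a => by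
        simp [TensorProduct.smul_tmul']
      rw [e r, e s, smul_mul_smul_comm, map_smul, map_smul, map_smul, key,
        smul_mul_smul_comm]

/-- The automorphisms of an algebra `B` over `k`, as a subgroup of the group of its linear
automorphisms. -/
def algebraAut (k B : Type*) [CommRing k] [NonUnitalNonAssocRing B] [Module k B] :
    Subgroup (B ≃ₗ[k] B) where
  carrier := {φ | ∀ x y, φ (x * y) = φ x * φ y}
  one_mem' _ _ := rfl
  mul_mem' {φ ψ} h h' x y := by
    change φ (ψ (x * y)) = φ (ψ x) * φ (ψ y)
    rw [h', h]
  inv_mem' {φ} h x y := by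
    apply φ.injective
    change φ (φ.symm (x * y)) = φ (φ.symm x * φ.symm y)
    rw [h, φ.apply_symm_apply, φ.apply_symm_apply, φ.apply_symm_apply]

variable (F A) in
/-- The automorphism group scheme of an algebra: its `R`-points are the automorphisms of the
`R`-algebra `R ⊗ A`. -/
noncomputable def autAlgebra : SubgroupFunctor (glFunctor F A) where
  obj R := algebraAut R (R ⊗[F] A)
  map_mem f _ h := glMap_mul f.hom h

end AutAlgebra

/-! ## Gradings -/

section Gradings

theorem eq_of_le_of_iSupIndep {L : Type*} [CompleteLattice L] [IsModularLattice L] {J : Type*}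
    {B C : J → L} (hC : iSupIndep C) (hle : ∀ j, B j ≤ C j) (hB : ⨆ j, B j = ⊤) : B = C := by
  funext j
  refine le_antisymm (hle j) ?_
  have h1 : B j ⊔ ⨆ k, ⨆ (_ : k ≠ j), C k = ⊤ := by
    rw [eq_top_iff, ← hB]
    refine iSup_le fun k => ?_
    by_cases hk : k = j
    · rw [hk]; exact le_sup_left
    · exact le_sup_of_le_right (le_iSup₂_of_le k hk (hle k))
  calc C j = (B j ⊔ ⨆ k, ⨆ (_ : k ≠ j), C k) ⊓ C j := by rw [h1, top_inf_eq]
    _ = B j ⊔ (⨆ k, ⨆ (_ : k ≠ j), C k) ⊓ C j := (sup_inf_assoc_of_le _ (hle j)).symm ▸ rfl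
    _ = B j := by rw [(hC j).symm.eq_bot, sup_bot_eq]
    _ ≤ B j := le_rfl

open Classical in
/-- A grading of the (not necessarily associative) algebra `A` over `F` by the abelian group `G`. -/
structure AlgebraGrading (F A G : Type u) [Field F] [NonUnitalNonAssocRing A] [Module F A]
    [CommGroup G] where
  comp : G → Submodule F A
  isInternal : DirectSum.IsInternal comp
  comp_mul : ∀ {g h : G} {x y : A}, x ∈ comp g → y ∈ comp h → x * y ∈ comp (g * h)

variable {F A G : Type u} [Field F] [NonUnitalNonAssocRing A] [Module F A] [CommGroup G]

namespace AlgebraGrading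

/-- The support of a grading. -/
abbrev supp (Γ : AlgebraGrading F A G) : Set G := support Γ.comp

theorem iSupIndep_comp (Γ : AlgebraGrading F A G) : iSupIndep Γ.comp := by
  classical
  exact DirectSum.IsInternal.submodule_iSupIndep (by convert Γ.isInternal)

theorem iSup_comp (Γ : AlgebraGrading F A G) : ⨆ g, Γ.comp g = ⊤ := by
  classical
  exact DirectSum.IsInternal.submodule_iSup_eq_top (by convert Γ.isInternal)

open Classical in
theorem isInternal_baseChange (Γ : AlgebraGrading F A G) (R : Type u) [CommRing R] [Algebra F R] :
    DirectSum.IsInternal fun g => (Γ.comp g).baseChange R :=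
  DirectSum.IsInternal.baseChange Γ.comp Γ.isInternal

/-! ### The ordinary Weyl group -/

section Ordinary

variable (Γ : AlgebraGrading F A G)

theorem comp_injective {s t : Γ.supp} (h : Γ.comp s = Γ.comp t) : s = t := by
  by_contra hne
  have h1 := Γ.iSupIndep_comp.pairwiseDisjoint (fun hh => hne (Subtype.ext hh) : (s : G) ≠ t)
  rw [Function.onFun, ← h] at h1
  exact s.2 (disjoint_self.1 h1)

theorem iSup_map (φ : A ≃ₗ[F] A) : ⨆ g, (Γ.comp g).map φ.toLinearMap = ⊤ := by
  rw [← Submodule.map_iSup, Γ.iSup_comp, Submodule.map_top]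
  exact LinearMap.range_eq_top.2 φ.surjective

variable [FiniteDimensional F A]

theorem exists_perm {φ : A ≃ₗ[F] A}
    (h : ∀ g, ∃ g', (Γ.comp g).map φ.toLinearMap ≤ Γ.comp g') :
    ∃ σ : Equiv.Perm Γ.supp, ∀ s : Γ.supp, (Γ.comp s).map φ.toLinearMap = Γ.comp (σ s) := by
  choose p hp using h
  have hne : ∀ s : Γ.supp, (Γ.comp s).map φ.toLinearMap ≠ ⊥ := fun s hs =>
    s.2 ((Submodule.map_eq_bot_iff (e := φ)).1 hs)
  have hsupp : ∀ s : Γ.supp, p s ∈ Γ.supp := fun s hs => hne s (le_bot_iff.1 (hs ▸ hp s))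
  have hfin : Finite Γ.supp := WellFoundedGT.finite_ne_bot_of_iSupIndep Γ.iSupIndep_comp
  let σ₀ : Γ.supp → Γ.supp := fun s => ⟨p s, hsupp s⟩
  have key : (fun g => ⨆ s : {s : Γ.supp // p s = g}, (Γ.comp s.1).map φ.toLinearMap) =
      Γ.comp := by
    refine eq_of_le_of_iSupIndep Γ.iSupIndep_comp (fun g => iSup_le ?_) ?_
    · rintro ⟨s, rfl⟩
      exact hp s
    · rw [eq_top_iff, ← Γ.iSup_map φ]
      refine iSup_le fun g => ?_
      by_cases hg : Γ.comp g = ⊥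
      · rw [hg, Submodule.map_bot]; exact bot_le
      · exact le_iSup_of_le (p g)
          (le_iSup (fun s : {s : Γ.supp // p s = p g} => (Γ.comp s.1).map φ.toLinearMap)
            ⟨⟨g, hg⟩, rfl⟩)
  have hsurj : Function.Surjective σ₀ := by
    intro t
    by_contra hcon
    have h1 := congrFun key t
    refine t.2 (h1.symm.trans (iSup_eq_bot.2 fun s => (hcon ⟨s.1, Subtype.ext s.2⟩).elim))
  have hinj : Function.Injective σ₀ := Finite.injective_iff_surjective.2 hsurj
  refine ⟨Equiv.ofBijective σ₀ ⟨hinj, hsurj⟩, fun s => le_antisymm (hp s) ?_⟩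
  change Γ.comp (p s) ≤ _
  rw [← congrFun key (p s)]
  refine iSup_le fun t => ?_
  rw [hinj (Subtype.ext t.2 : σ₀ t.1 = σ₀ s)]

/-- The automorphism group `Aut(Γ)` of a grading. -/
def autGroup : Subgroup (A ≃ₗ[F] A) where
  carrier := {φ | φ ∈ algebraAut F A ∧ ∀ g, ∃ h, (Γ.comp g).map φ.toLinearMap ≤ Γ.comp h}
  one_mem' := ⟨one_mem _, fun g => ⟨g, (Submodule.map_id _).le⟩⟩
  mul_mem' {φ ψ} := by
    rintro ⟨h1, h⟩ ⟨h1', h'⟩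
    refine ⟨mul_mem h1 h1', fun g => ?_⟩
    obtain ⟨k, hk⟩ := h' g
    obtain ⟨l, hl⟩ := h k
    have : (φ * ψ).toLinearMap = φ.toLinearMap ∘ₗ ψ.toLinearMap := rfl
    refine ⟨l, ?_⟩
    rw [this, Submodule.map_comp]
    exact (Submodule.map_mono hk).trans hl
  inv_mem' {φ} := by
    rintro ⟨h1, h⟩
    refine ⟨inv_mem h1, fun g => ?_⟩
    obtain ⟨σ, hσ⟩ := Γ.exists_perm h
    by_cases hg : Γ.comp g = ⊥
    · exact ⟨g, by rw [hg, Submodule.map_bot]⟩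
    · have h2 := hσ (σ.symm ⟨g, hg⟩)
      rw [Equiv.apply_symm_apply] at h2
      have : φ⁻¹.toLinearMap ∘ₗ φ.toLinearMap = LinearMap.id := by
        ext x; exact φ.symm_apply_apply _
      refine ⟨σ.symm ⟨g, hg⟩, ?_⟩
      change Submodule.map _ (Γ.comp (⟨g, hg⟩ : Γ.supp)) ≤ _
      rw [← h2, ← Submodule.map_comp, this, Submodule.map_id]

/-- The stabilizer `Stab(Γ)` of a grading. -/
def stabGroup : Subgroup (A ≃ₗ[F] A) where
  carrier := {φ | φ ∈ algebraAut F A ∧ ∀ g, (Γ.comp g).map φ.toLinearMap ≤ Γ.comp g}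
  one_mem' := ⟨one_mem _, fun g => (Submodule.map_id _).le⟩
  mul_mem' {φ ψ} := by
    rintro ⟨h1, h⟩ ⟨h1', h'⟩
    refine ⟨mul_mem h1 h1', fun g => ?_⟩
    have : (φ * ψ).toLinearMap = φ.toLinearMap ∘ₗ ψ.toLinearMap := rfl
    rw [this, Submodule.map_comp]
    exact (Submodule.map_mono (h' g)).trans (h g)
  inv_mem' {φ} := by
    rintro ⟨h1, h⟩
    refine ⟨inv_mem h1, fun g => ?_⟩
    have h2 := congrFun (eq_of_le_of_iSupIndep Γ.iSupIndep_comp h (Γ.iSup_map φ)) g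
    have : φ⁻¹.toLinearMap ∘ₗ φ.toLinearMap = LinearMap.id := by
      ext x; exact φ.symm_apply_apply _
    conv_lhs => rw [← h2]
    rw [← Submodule.map_comp, this, Submodule.map_id]

/-- The permutation of the support induced by an automorphism of a grading: `φ(A_s) = A_{σ(s)}`. -/
noncomputable def permHom : Γ.autGroup →* Equiv.Perm Γ.supp :=
  MonoidHom.mk' (fun φ => (Γ.exists_perm φ.2.2).choose) fun φ ψ => by
    ext1 s
    apply Γ.comp_injective
    refine ((Γ.exists_perm (φ * ψ).2.2).choose_spec s).symm.trans ?_
    rw [Equiv.Perm.mul_apply, ← (Γ.exists_perm φ.2.2).choose_spec,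
      ← (Γ.exists_perm ψ.2.2).choose_spec, ← Submodule.map_comp]
    rfl

theorem permHom_spec (φ : Γ.autGroup) (s : Γ.supp) :
    (Γ.comp s).map φ.1.toLinearMap = Γ.comp (Γ.permHom φ s) :=
  (Γ.exists_perm φ.2.2).choose_spec s

theorem ker_permHom : Γ.permHom.ker = Γ.stabGroup.subgroupOf Γ.autGroup := by
  ext φ
  rw [MonoidHom.mem_ker, Subgroup.mem_subgroupOf]
  constructor
  · refine fun h => ⟨φ.2.1, fun g => ?_⟩
    by_cases hg : Γ.comp g = ⊥
    · rw [hg, Submodule.map_bot]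
    · have := Γ.permHom_spec φ ⟨g, hg⟩
      rw [h] at this
      exact this.le
  · rintro ⟨-, h⟩
    ext1 s
    apply Γ.comp_injective
    rw [← Γ.permHom_spec]
    exact congrFun (eq_of_le_of_iSupIndep Γ.iSupIndep_comp h (Γ.iSup_map φ.1)) s

instance : (Γ.stabGroup.subgroupOf Γ.autGroup).Normal :=
  Γ.ker_permHom ▸ MonoidHom.normal_ker _

/-- The Weyl group `W(Γ) = Aut(Γ) / Stab(Γ)` of a grading. -/
abbrev WeylGroup : Type u := Γ.autGroup ⧸ Γ.stabGroup.subgroupOf Γ.autGroup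

/-- The action of the Weyl group on the support, through which it is identified with a subgroup
of the symmetric group of the support. -/
noncomputable def weylPerm : Γ.WeylGroup →* Equiv.Perm Γ.supp :=
  QuotientGroup.lift _ Γ.permHom Γ.ker_permHom.ge

theorem weylPerm_injective : Function.Injective Γ.weylPerm := by
  rw [injective_iff_map_eq_one]
  intro w
  induction w using QuotientGroup.induction_on with
  | H φ =>
    intro h
    rw [QuotientGroup.eq_one_iff, ← Γ.ker_permHom]
    exact h

end Ordinary

/-! ### The automorphism group scheme and the Weyl group scheme -/

section Scheme

variable (Γ : AlgebraGrading F A G)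

variable {R : Type u} [CommRing R] [Algebra F R]

theorem permutes_unique {φ : (R ⊗[F] A) ≃ₗ[R] (R ⊗[F] A)} (P : PrimeSpectrum R) {d e : R}
    {σ τ : Equiv.Perm Γ.supp} (hd : d ∉ P.asIdeal) (he : e ∉ P.asIdeal)
    (h : Permutes Γ.comp φ d σ) (h' : Permutes Γ.comp φ e τ) : σ = τ := by
  classical
  ext1 s
  by_contra hne
  have h1 := (h.mul_left e s).symm.trans (mul_comm e d ▸ h'.mul_left d s)
  have hde : e * d ≠ 0 := fun h0 =>
    (P.2.mem_or_mem (h0 ▸ P.asIdeal.zero_mem : e * d ∈ P.asIdeal)).elim he hd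
  have hind : iSupIndep fun g => (Γ.comp g).baseChange R :=
    (Γ.isInternal_baseChange R).submodule_iSupIndep
  have hle : ∀ g, piece R (Γ.comp g) (e * d) ≤ (Γ.comp g).baseChange R := by
    rintro g _ ⟨x, hx, rfl⟩
    exact Submodule.smul_mem _ _ hx
  have hdis := (hind.pairwiseDisjoint (fun hh => hne (Subtype.ext hh) : (σ s : G) ≠ τ s)).mono
    (hle _) (hle _)
  rw [h1, disjoint_self] at hdis
  obtain ⟨v, hv, hv0⟩ := (Submodule.ne_bot_iff _).1 (τ s).2
  have h2 : (e * d) ⊗ₜ[F] v ∈ piece R (Γ.comp (τ s)) (e * d) := by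
    rw [piece_eq_span]
    exact Submodule.subset_span ⟨v, hv, rfl⟩
  rw [hdis, Submodule.mem_bot] at h2
  refine hv0 ((Module.forall_dual_apply_eq_zero_iff F v).1 fun f => by_contra fun hf => hde ?_)
  have h3 := congrArg (fun x => TensorProduct.rid F R (LinearMap.lTensor R f x)) h2
  simp only [LinearMap.lTensor_tmul, TensorProduct.rid_tmul, map_zero] at h3
  exact (smul_eq_zero_iff_right hf).1 h3

theorem exists_permutes {φ : (R ⊗[F] A) ≃ₗ[R] (R ⊗[F] A)} (h : LocallyPermutes Γ.comp φ)
    (P : PrimeSpectrum R) :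
    ∃ σ : Equiv.Perm Γ.supp, ∃ e ∉ P.asIdeal, Permutes Γ.comp φ e σ := by
  obtain ⟨n, e, σ, he, -, h⟩ := h
  by_contra! hcon
  refine P.2.ne_top ((Ideal.eq_top_iff_one _).2 ?_)
  rw [← he.complete]
  exact sum_mem fun i _ => by_contra fun hi => hcon (σ i) (e i) hi (h i)

/-- The locally constant family of permutations of the support induced by an `R`-point `φ` of the
automorphism group scheme: if `φ(Re ⊗ A_s) = Re ⊗ A_{σ(s)}` for all `s`, then its value is `σ` at
all primes that do not contain `e`. -/
noncomputable def localPerm {φ : (R ⊗[F] A) ≃ₗ[R] (R ⊗[F] A)} (h : LocallyPermutes Γ.comp φ) :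
    LocallyConstant (PrimeSpectrum R) (Equiv.Perm Γ.supp) where
  toFun P := (Γ.exists_permutes h P).choose
  isLocallyConstant := by
    rw [IsLocallyConstant.iff_exists_open]
    intro P
    obtain ⟨e, he, hp⟩ := (Γ.exists_permutes h P).choose_spec
    refine ⟨PrimeSpectrum.basicOpen e, PrimeSpectrum.isOpen_basicOpen, he, fun Q hQ => ?_⟩
    obtain ⟨e', he', hp'⟩ := (Γ.exists_permutes h Q).choose_spec
    exact Γ.permutes_unique Q he' hQ hp' hp

theorem localPerm_eq {φ : (R ⊗[F] A) ≃ₗ[R] (R ⊗[F] A)} (h : LocallyPermutes Γ.comp φ)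
    (P : PrimeSpectrum R) {e : R} (he : e ∉ P.asIdeal) {σ : Equiv.Perm Γ.supp}
    (hp : Permutes Γ.comp φ e σ) : Γ.localPerm h P = σ := by
  obtain ⟨e', he', hp'⟩ := (Γ.exists_permutes h P).choose_spec
  exact Γ.permutes_unique P he' he hp' hp

variable [IsScalarTower F A A] [SMulCommClass F A A]

/-- The stabilizer group scheme of a grading. -/
noncomputable def stabScheme : SubgroupFunctor (glFunctor F A) :=
  (autAlgebra F A).inter (stabDecomposition Γ.comp)

/-- The automorphism group scheme of a grading. -/
noncomputable def autScheme : SubgroupFunctor (glFunctor F A) :=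
  (autAlgebra F A).inter (glDecomposition Γ.comp)

theorem stabScheme_le_autScheme (R : CommAlgCat.{u} F) : Γ.stabScheme.obj R ≤ Γ.autScheme.obj R :=
  fun _ h => ⟨h.1, LocallyPermutes.of_stabilizes h.2⟩

/-- The natural morphism from the automorphism group scheme of a grading to the constant group
scheme associated to the symmetric group of the support. -/
noncomputable def autToSym :
    Γ.autScheme.toFunctor ⟶ constantGroupScheme F (Equiv.Perm Γ.supp) where
  app R := GrpCat.ofHom (X := Γ.autScheme.obj R)
    (Y := LocallyConstant (PrimeSpectrum R) (Equiv.Perm Γ.supp))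
    (MonoidHom.mk' (fun φ => Γ.localPerm (R := R) φ.2.2) fun φ ψ => by
      ext1 P
      obtain ⟨d, hd, h⟩ := (Γ.exists_permutes φ.2.2 P).choose_spec
      obtain ⟨e, he, h'⟩ := (Γ.exists_permutes ψ.2.2 P).choose_spec
      refine Γ.localPerm_eq _ P (e := d * e) (P.2.mul_notMem hd he) ?_
      exact (mul_comm e d ▸ h.mul_left e).mul (h'.mul_left d))
  naturality R S f := by
    ext φ
    refine LocallyConstant.ext fun P => ?_
    obtain ⟨e, he, h⟩ :=
      (Γ.exists_permutes φ.2.2 (PrimeSpectrum.comap f.hom.toRingHom P)).choose_spec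
    exact Γ.localPerm_eq (LocallyPermutes.glMap φ.2.2 f.hom) P (e := f.hom e) he (h.glMap f.hom)

/-- The Weyl group scheme of a grading: the image of the natural morphism from the automorphism
group scheme to the constant group scheme of permutations of the support. -/
noncomputable def weylScheme :
    SubgroupFunctor (constantGroupScheme F (Equiv.Perm Γ.supp)) :=
  image Γ.autToSym

/-! ### Extension of scalars -/

variable (K : Type u) [Field K] [Algebra F K]

/-- The grading `Γ_K` of the `K`-algebra `K ⊗ A`, with components `K ⊗ A_g`. -/
noncomputable def baseChange : AlgebraGrading K (K ⊗[F] A) G where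
  comp g := (Γ.comp g).baseChange K
  isInternal := Γ.isInternal_baseChange K
  comp_mul {g h x y} hx hy := by
    rw [Submodule.baseChange_eq_span] at hx hy
    induction hx using Submodule.span_induction with
    | zero => simp
    | add x x' _ _ hx hx' => rw [add_mul]; exact add_mem hx hx'
    | smul r x _ hx => rw [smul_mul_assoc]; exact Submodule.smul_mem _ _ hx
    | mem x hx =>
      obtain ⟨a, ha, rfl⟩ := hx
      induction hy using Submodule.span_induction with
      | zero => simp
      | add y y' _ _ hy hy' => rw [mul_add]; exact add_mem hy hy'
      | smul r y _ hy => rw [mul_smul_comm]; exact Submodule.smul_mem _ _ hy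
      | mem y hy =>
        obtain ⟨b, hb, rfl⟩ := hy
        simpa using Submodule.tmul_mem_baseChange_of_mem (1 : K) (Γ.comp_mul ha hb)

theorem supp_baseChange : (Γ.baseChange K).supp = Γ.supp := by
  ext g
  refine not_congr ⟨fun h => ?_, fun h => ?_⟩
  · refine Submodule.baseChange_injective (A := K) ?_
    rw [Submodule.baseChange_bot]
    exact h
  · change (Γ.comp g).baseChange K = ⊥
    rw [h, Submodule.baseChange_bot]

/-- The action of the Weyl group of `Γ_K` on the support of `Γ`, which is also that of `Γ_K`. -/
noncomputable def weylPermBaseChange [FiniteDimensional F A] :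
    (Γ.baseChange K).WeylGroup →* Equiv.Perm Γ.supp :=
  (Equiv.permCongrHom (Equiv.setCongr (Γ.supp_baseChange K))).toMonoidHom.comp
    (Γ.baseChange K).weylPerm

end Scheme

end AlgebraGrading

end Gradings

end GradingScheme

/-!
All group functors here are compared inside the constant group scheme of permutations of the
support, and the heart of the matter is that the image of the automorphism group scheme in it is
the constant group scheme of the subgroup `H` of those permutations that come from the Weyl group
of `Γ_K` (`weylScheme_obj`). Both inclusions are shown on points.

*The image lies in the constant group scheme of `H`.* The latter is a closed subgroup functor
(`constantSubgroupFunctor_isClosed`): the locus where a locally constant function leaves `H` is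
clopen, so it is the basic open set of an idempotent. It remains to see that all values of the
family of permutations attached to an `R`-point `φ` lie in `H`. Such a value `σ` is induced by `φ`
on the part of `R ⊗ A` cut out by a nonzero idempotent `e`. The matrix entries of `φ` and `φ⁻¹`,
together with `e`, generate a finitely generated subalgebra `R₀` of `R`, over which `φ` is defined
(`exists_fg_glMap_eq`). The relation between `φ`, `e` and `σ` descends to `R₀`, because membership
in the extension of a subspace does not depend on the scalars (`mem_baseChange_of_extMap_mem`). By
the Nullstellensatz there is a homomorphism `R₀ → K` with `e ↦ 1` (`exists_algHom_ne_zero`), and it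
specializes `φ` to an automorphism of `K ⊗ A` that induces `σ`
(`mem_range_weylPermBaseChange_of_permutes`).

*The image contains the constant group scheme of `H`.* A closed subgroup functor through which the
morphism factors contains each `σ ∈ H` as a constant function over `K`. As `F → K` is injective,
closedness gives the constant function `σ` over `F`, hence over every algebra
(`SubgroupFunctor.IsClosed.const_mem`). A general locally constant function with values in `H`
becomes constant over each local ring of `R`, and the ideal of `R` that cuts out the condition of
membership is therefore zero (`SubgroupFunctor.IsClosed.mem_of_const_mem`).

The isomorphism follows since the Weyl group of `Γ_K` acts faithfully on the support. Exactness
over `K` follows since `Spec K` is a point: a `K`-point of the automorphism group scheme induces a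
single permutation, which is trivial exactly on the stabilizer.
-/

namespace GradingScheme

/-! ### Closed subgroup schemes of constant group schemes -/

section ConstantSubgroups

variable {F : Type u} [Field F] {W : Type u} [Group W]

variable (F) in
/-- The constant group scheme of a subgroup `H` of `W`, as a subgroup functor of the constant group
scheme of `W`: the locally constant functions with values in `H`. -/
noncomputable def constantSubgroupFunctor (H : Subgroup W) :
    SubgroupFunctor (constantGroupScheme F W) where
  obj R :=
    { carrier := {c : LocallyConstant (PrimeSpectrum R) W | ∀ P, c P ∈ H}
      one_mem' := fun _ => H.one_mem
      mul_mem' := fun h h' P => H.mul_mem (h P) (h' P)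
      inv_mem' := fun h P => H.inv_mem (h P) }
  map_mem f _ h P := h (PrimeSpectrum.comap f.hom.toRingHom P)

/-- The locus where a locally constant function takes values outside `H` is the basic open set of
an idempotent, and this idempotent generates the required ideal. -/
theorem constantSubgroupFunctor_isClosed (H : Subgroup W) :
    (constantSubgroupFunctor F H).IsClosed := by
  intro R c
  change LocallyConstant (PrimeSpectrum R) W at c
  have hclopen : IsClopen {P : PrimeSpectrum R | c P ∉ H} :=
    ⟨(c.isLocallyConstant (H : Set W)).isClosed_compl,
      c.isLocallyConstant {w | w ∉ H}⟩
  obtain ⟨e, he, hU⟩ := PrimeSpectrum.exists_idempotent_basicOpen_eq_of_isClopen hclopen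
  have hmem : ∀ P : PrimeSpectrum R, c P ∈ H ↔ e ∈ P.asIdeal := fun P => by
    have h1 : P ∈ {P : PrimeSpectrum R | c P ∉ H} ↔ P ∈ PrimeSpectrum.basicOpen e := by
      rw [hU]; rfl
    rw [PrimeSpectrum.mem_basicOpen] at h1
    exact not_iff_not.1 h1
  refine ⟨Ideal.span {e}, fun S f => ?_⟩
  rw [Ideal.span_singleton_le_iff_mem, RingHom.mem_ker]
  change (∀ P : PrimeSpectrum S, c (PrimeSpectrum.comap f.hom.toRingHom P) ∈ H) ↔ f.hom e = 0
  simp only [hmem]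
  constructor
  · intro h
    -- an idempotent that lies in all primes is nilpotent, hence zero
    have hnil : IsNilpotent (f.hom e) := by
      rw [← mem_nilradical, nilradical_eq_sInf, Submodule.mem_sInf]
      exact fun J (hJ : Ideal.IsPrime J) => h ⟨J, hJ⟩
    exact (he.map f.hom).eq_zero_of_isNilpotent hnil
  · intro h P
    change f.hom e ∈ P.asIdeal
    rw [h]
    exact P.asIdeal.zero_mem

/-- A closed subgroup scheme of a constant group scheme that contains a constant function over
some nonzero algebra `S` contains it over `F`, because `F → S` is injective, hence over every
algebra. -/
theorem SubgroupFunctor.IsClosed.const_mem {H : SubgroupFunctor (constantGroupScheme F W)}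
    (hH : H.IsClosed) {S : CommAlgCat.{u} F} [Nontrivial S] {w : W}
    (hw : LocallyConstant.const (PrimeSpectrum S) w ∈ H.obj S) (R : CommAlgCat.{u} F) :
    LocallyConstant.const (PrimeSpectrum R) w ∈ H.obj R := by
  obtain ⟨I, hI⟩ := hH (CommAlgCat.of F F) (LocallyConstant.const (PrimeSpectrum F) w)
  have hS := (hI S (CommAlgCat.ofHom (Algebra.ofId F S))).1 hw
  have hbot : I = ⊥ := by
    rw [eq_bot_iff]
    refine hS.trans fun x hx => ?_
    exact (algebraMap F S).injective (hx.trans (map_zero _).symm)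
  exact (hI R (CommAlgCat.ofHom (Algebra.ofId F R))).2 (hbot ▸ bot_le)

/-- Membership in a closed subgroup scheme of a constant group scheme can be tested on values: a
locally constant function is constant on the spectrum of each localization `R_P`, since every
prime of `R_P` is a generization of `P`, and an ideal of `R` that vanishes in all the `R_P` is
zero. -/
theorem SubgroupFunctor.IsClosed.mem_of_const_mem {H : SubgroupFunctor (constantGroupScheme F W)}
    (hH : H.IsClosed) {R : CommAlgCat.{u} F} (c : LocallyConstant (PrimeSpectrum R) W)
    (hc : ∀ (P : PrimeSpectrum R) (S : CommAlgCat.{u} F),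
      LocallyConstant.const (PrimeSpectrum S) (c P) ∈ H.obj S) :
    c ∈ H.obj R := by
  obtain ⟨I, hI⟩ := hH R c
  suffices hbot : I = ⊥ by
    have h := (hI R (𝟙 R)).2 (hbot ▸ bot_le)
    rwa [CategoryTheory.Functor.map_id] at h
  refine bot_unique fun r hr => eq_zero_of_localization r fun J hJ => ?_
  let f : R ⟶ CommAlgCat.of F (Localization.AtPrime J) :=
    CommAlgCat.ofHom (IsScalarTower.toAlgHom F R (Localization.AtPrime J))
  refine (hI _ f).1 ?_ hr
  have hconst : (constantGroupScheme F W).map f c = LocallyConstant.const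
      (PrimeSpectrum (Localization.AtPrime J)) (c ⟨J, hJ.isPrime⟩) := by
    refine LocallyConstant.ext fun Q => ?_
    change c (PrimeSpectrum.comap f.hom.toRingHom Q) = c ⟨J, hJ.isPrime⟩
    have hle : PrimeSpectrum.comap f.hom.toRingHom Q ≤ ⟨J, hJ.isPrime⟩ := by
      intro x hx
      by_contra hxJ
      exact Q.2.ne_top (Ideal.eq_top_of_isUnit_mem _ hx
        (IsLocalization.map_units (Localization.AtPrime J) (⟨x, hxJ⟩ : J.primeCompl)))
    exact (((PrimeSpectrum.le_iff_specializes _ _).1 hle).mem_open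
      (c.isLocallyConstant.isOpen_fiber (c ⟨J, hJ.isPrime⟩)) rfl)
  rw [hconst]
  exact hc _ _

/-- The image of a morphism `θ` to a constant group scheme is the constant group scheme of `H`,
provided that all values of `θ` lie in `H` and that each element of `H` is the value of `θ` at some
point over a nonzero algebra. -/
theorem image_obj_eq_constantSubgroupFunctor {X : CommAlgCat.{u} F ⥤ GrpCat.{u}}
    (θ : X ⟶ constantGroupScheme F W) (H : Subgroup W)
    (hle : FactorsThrough θ (constantSubgroupFunctor F H))
    (S : CommAlgCat.{u} F) [Nontrivial S]
    (hge : ∀ w ∈ H, ∃ x : X.obj S, θ.app S x = LocallyConstant.const (PrimeSpectrum S) w)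
    (R : CommAlgCat.{u} F) : (image θ).obj R = (constantSubgroupFunctor F H).obj R := by
  refine le_antisymm (image_le θ _ (constantSubgroupFunctor_isClosed H) hle R) fun c hc => ?_
  refine (image_isClosed θ).mem_of_const_mem c fun P T => ?_
  obtain ⟨x, hx⟩ := hge _ (hc P)
  exact (image_isClosed θ).const_mem (S := S) (hx ▸ image_factorsThrough θ S x) T

/-- An injective homomorphism of groups identifies the constant group scheme of its source with
that of its range. -/
theorem exists_iso_constantGroupScheme {W' : Type u} [Group W'] (h : W' →* W)
    (hinj : Function.Injective h) (Z : SubgroupFunctor (constantGroupScheme F W))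
    (hZ : ∀ R, Z.obj R = (constantSubgroupFunctor F h.range).obj R) :
    ∃ e : Z.toFunctor ≅ constantGroupScheme F W',
      e.hom ≫ constantGroupSchemeMap F h = Z.ι := by
  have hmem : ∀ R (c : (constantGroupScheme F W').obj R),
      (constantGroupSchemeMap F h).app R c ∈ Z.obj R := by
    intro R c
    rw [hZ]
    exact fun P => ⟨c.toFun P, rfl⟩
  let ν : constantGroupScheme F W' ⟶ Z.toFunctor :=
    { app R := GrpCat.ofHom
        (((constantGroupSchemeMap F h).app R).hom.codRestrict (Z.obj R) (hmem R))
      naturality R S f := rfl }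
  have hbij : ∀ R, Function.Bijective (ν.app R).hom := by
    intro R
    constructor
    · intro c c' hcc
      refine LocallyConstant.ext fun P => hinj ?_
      exact congrArg (fun z => (z.1 : LocallyConstant (PrimeSpectrum R) W) P) hcc
    · rintro ⟨c, hc⟩
      have hc' := hc
      rw [hZ] at hc'
      refine ⟨LocallyConstant.map (Function.invFun h) c, Subtype.ext ?_⟩
      refine LocallyConstant.ext fun P => ?_
      exact Function.invFun_eq (hc' P)
  have hiso : ∀ R, IsIso (ν.app R) := fun R =>
    (ConcreteCategory.isIso_iff_bijective (ν.app R)).2 (hbij R)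
  have : IsIso ν := NatIso.isIso_of_isIso_app ν
  refine ⟨(asIso ν).symm, ?_⟩
  rw [Iso.symm_hom, Iso.inv_comp_eq]
  rfl

end ConstantSubgroups

/-! ### Points of finitely generated algebras -/

/-- Nullstellensatz: an element of a finitely generated algebra that is not nilpotent does not
vanish at some point with values in a given algebraically closed extension of the base field. -/
theorem exists_algHom_ne_zero {F R : Type*} [Field F] [CommRing R] [Algebra F R]
    [Algebra.FiniteType F R] (K : Type*) [Field K] [Algebra F K] [IsAlgClosed K] {e : R}
    (he : ¬ IsNilpotent e) : ∃ f : R →ₐ[F] K, f e ≠ 0 := by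
  have : Nontrivial (Localization.Away e) := by
    rwa [← not_subsingleton_iff_nontrivial,
      IsLocalization.subsingleton_iff (M := Submonoid.powers e)]
  have : Algebra.FiniteType R (Localization.Away e) :=
    IsLocalization.finiteType_of_monoid_fg (Submonoid.powers e) _
  have : Algebra.FiniteType F (Localization.Away e) := .trans ‹_› this
  obtain ⟨m, hm⟩ := Ideal.exists_maximal (Localization.Away e)
  let := Ideal.Quotient.field m
  have : Module.Finite F (Localization.Away e ⧸ m) := finite_of_finite_type_of_isJacobsonRing _ _
  let f : Localization.Away e →ₐ[F] K :=
    (IsAlgClosed.lift (M := K) (S := Localization.Away e ⧸ m)).comp (Ideal.Quotient.mkₐ F m)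
  refine ⟨f.comp (IsScalarTower.toAlgHom F R _), ?_⟩
  exact ((IsLocalization.Away.algebraMap_isUnit (S := Localization.Away e) e).map f).ne_zero

/-! ### Descent of automorphisms to finitely generated algebras -/

section Descent

variable {F : Type u} [Field F] {V : Type u} [AddCommGroup V] [Module F V]
variable {R S : Type u} [CommRing R] [Algebra F R] [CommRing S] [Algebra F S]

theorem extMap_injective {f : R →ₐ[F] S} (hf : Function.Injective f) :
    Function.Injective (extMap V f) :=
  Module.Flat.rTensor_preserves_injective_linearMap f.toLinearMap hf

theorem mem_baseChange_iff (N : Submodule F V) (x : R ⊗[F] V) :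
    x ∈ N.baseChange R ↔ LinearMap.lTensor R N.mkQ x = 0 := by
  rw [← LinearMap.mem_ker, lTensor_mkQ]
  exact Iff.rfl

/-- Whether a vector of `R ⊗ V` lies in `R ⊗ N` can be tested after an extension of scalars. -/
theorem mem_baseChange_of_extMap_mem {f : R →ₐ[F] S} (hf : Function.Injective f)
    {N : Submodule F V} {x : R ⊗[F] V} (hx : extMap V f x ∈ N.baseChange S) :
    x ∈ N.baseChange R := by
  rw [mem_baseChange_iff] at hx ⊢
  apply extMap_injective hf
  rw [map_zero, ← hx]
  exact (LinearMap.congr_fun (LinearMap.rTensor_comp_lTensor ..) x).trans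
    (LinearMap.congr_fun (LinearMap.lTensor_comp_rTensor ..) x).symm

/-- Membership in `Re ⊗ N`, for an idempotent `e`, can be tested after an extension of scalars. -/
theorem extMap_mem_piece_iff {f : R →ₐ[F] S} (hf : Function.Injective f) {N : Submodule F V}
    {e : R} (he : IsIdempotentElem e) {x : R ⊗[F] V} :
    extMap V f x ∈ piece S N (f e) ↔ x ∈ piece R N e := by
  constructor
  · rintro ⟨y, hy, hyx⟩
    have hx : extMap V f x ∈ N.baseChange S := by
      rw [← hyx]
      exact Submodule.smul_mem _ _ hy
    refine ⟨x, mem_baseChange_of_extMap_mem hf hx, extMap_injective hf ?_⟩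
    change extMap V f (e • x) = _
    rw [extMap_smul, ← hyx]
    change f e • f e • y = f e • y
    rw [smul_smul, ← map_mul, he.eq]
  · intro hx
    rw [piece_map]
    exact Submodule.subset_span ⟨x, hx, rfl⟩

theorem mem_map_equiv_iff {φ : (R ⊗[F] V) ≃ₗ[R] (R ⊗[F] V)} {N : Submodule R (R ⊗[F] V)}
    {x : R ⊗[F] V} : x ∈ N.map φ.toLinearMap ↔ φ⁻¹ x ∈ N :=
  Submodule.mem_map_equiv N

/-- The condition to permute the pieces cut out by an idempotent descends along injective
homomorphisms. -/
theorem permutes_of_glMap {I : Type u} {𝒱 : I → Submodule F V} {f : R →ₐ[F] S}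
    (hf : Function.Injective f) {φ : (R ⊗[F] V) ≃ₗ[R] (R ⊗[F] V)} {e : R}
    (he : IsIdempotentElem e) {σ : Equiv.Perm (support 𝒱)}
    (h : Permutes 𝒱 (glMap f φ) (f e) σ) : Permutes 𝒱 φ e σ := by
  intro s
  ext x
  rw [mem_map_equiv_iff, ← extMap_mem_piece_iff hf he, ← extMap_mem_piece_iff hf he, ← h s,
    mem_map_equiv_iff, ← map_inv, glMap_extMap]

theorem mem_algebraAut_of_glMap {A : Type u} [NonUnitalNonAssocRing A] [Module F A]
    [IsScalarTower F A A] [SMulCommClass F A A] {f : R →ₐ[F] S} (hf : Function.Injective f)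
    {φ : (R ⊗[F] A) ≃ₗ[R] (R ⊗[F] A)} (h : glMap f φ ∈ algebraAut S (S ⊗[F] A)) :
    φ ∈ algebraAut R (R ⊗[F] A) := by
  intro x y
  apply extMap_injective hf
  rw [← glMap_extMap, extMap_mul, h, glMap_extMap, glMap_extMap, extMap_mul]

/-- An endomorphism of `R ⊗ V` whose matrix entries lie in a subalgebra `R₀` is defined over
`R₀`. -/
theorem exists_endMap_eq [FiniteDimensional F V] {ι : Type*} (b : Module.Basis ι F V)
    {R₀ : Subalgebra F R} (φ : R ⊗[F] V →ₗ[R] R ⊗[F] V)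
    (hR₀ : ∀ i j, (b.baseChange R).repr (φ (1 ⊗ₜ b j)) i ∈ R₀) :
    ∃ φ₀ : R₀ ⊗[F] V →ₗ[R₀] R₀ ⊗[F] V, endMap R₀.val φ₀ = φ := by
  have : Fintype ι := FiniteDimensional.fintypeBasisIndex b
  refine ⟨(b.baseChange R₀).constr R₀ fun j => ∑ i, (⟨_, hR₀ i j⟩ : R₀) ⊗ₜ b i, ?_⟩
  refine (b.baseChange R).ext fun j => ?_
  have h1 : b.baseChange R j = extMap V R₀.val (b.baseChange R₀ j) := by simp
  rw [h1, endMap_extMap, Module.Basis.constr_basis, map_sum, ← h1]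
  conv_rhs => rw [← (b.baseChange R).sum_repr (φ _)]
  refine Finset.sum_congr rfl fun i _ => ?_
  simp [TensorProduct.smul_tmul']

/-- An automorphism of `R ⊗ V` has finitely many matrix entries, so that it is defined over a
finitely generated subalgebra of `R`, which may be chosen to contain a given element. -/
theorem exists_fg_glMap_eq [FiniteDimensional F V] (φ : (R ⊗[F] V) ≃ₗ[R] (R ⊗[F] V)) (e : R) :
    ∃ R₀ : Subalgebra F R, R₀.FG ∧ e ∈ R₀ ∧
      ∃ φ₀ : (R₀ ⊗[F] V) ≃ₗ[R₀] (R₀ ⊗[F] V), glMap R₀.val φ₀ = φ := by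
  let b := Module.finBasis F V
  let s : Set R := {e} ∪
    (Set.range (fun p : _ × _ => (b.baseChange R).repr (φ (1 ⊗ₜ b p.2)) p.1) ∪
      Set.range (fun p : _ × _ => (b.baseChange R).repr (φ.symm (1 ⊗ₜ b p.2)) p.1))
  have hs : s.Finite := (Set.finite_singleton e).union ((Set.finite_range _).union
    (Set.finite_range _))
  obtain ⟨φ₀, hφ₀⟩ := exists_endMap_eq b (R₀ := Algebra.adjoin F s) φ.toLinearMap
    fun i j => Algebra.subset_adjoin (.inr (.inl ⟨(i, j), rfl⟩))
  obtain ⟨ψ₀, hψ₀⟩ := exists_endMap_eq b (R₀ := Algebra.adjoin F s) φ.symm.toLinearMap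
    fun i j => Algebra.subset_adjoin (.inr (.inr ⟨(i, j), rfl⟩))
  have hinj : Function.Injective (extMap V (Algebra.adjoin F s).val) :=
    extMap_injective Subtype.val_injective
  refine ⟨Algebra.adjoin F s, Subalgebra.fg_def.2 ⟨s, hs, rfl⟩, Algebra.subset_adjoin (.inl rfl),
    LinearEquiv.ofLinearMap φ₀ ψ₀ (LinearMap.ext fun x => hinj ?_)
      (LinearMap.ext fun x => hinj ?_), LinearEquiv.toLinearMap_injective hφ₀⟩
  · rw [LinearMap.comp_apply, ← endMap_extMap, ← endMap_extMap, hφ₀, hψ₀]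
    exact φ.apply_symm_apply _
  · rw [LinearMap.comp_apply, ← endMap_extMap, ← endMap_extMap, hφ₀, hψ₀]
    exact φ.symm_apply_apply _

end Descent

/-! ### Points of the automorphism group scheme of a grading -/

theorem LocallyPermutes.of_permutes_one {F V I R : Type u} [Field F] [AddCommGroup V]
    [Module F V] [CommRing R] [Algebra F R] {𝒱 : I → Submodule F V}
    {φ : (R ⊗[F] V) ≃ₗ[R] (R ⊗[F] V)} {σ : Equiv.Perm (support 𝒱)}
    (h : Permutes 𝒱 φ (1 : R) σ) : LocallyPermutes 𝒱 φ :=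
  LocallyPermutes.of_fintype (fun _ : Unit => (1 : R)) (fun _ => σ)
    (by rw [CompleteOrthogonalIdempotents.iff_ortho_complete]
        exact ⟨fun i j hij => (hij (Subsingleton.elim i j)).elim, by simp⟩)
    fun _ => h

namespace AlgebraGrading

variable {F A G : Type u} [Field F] [NonUnitalNonAssocRing A] [Module F A] [CommGroup G]
  (Γ : AlgebraGrading F A G)

theorem stabilizes_iff_permutes_one {R : Type u} [CommRing R] [Algebra F R]
    (φ : (R ⊗[F] A) ≃ₗ[R] (R ⊗[F] A)) :
    Stabilizes Γ.comp φ ↔ Permutes Γ.comp φ (1 : R) 1 := by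
  refine ⟨fun h s => by rw [piece_one, h s, Equiv.Perm.one_apply, piece_one], fun h g => ?_⟩
  by_cases hg : Γ.comp g = ⊥
  · rw [hg, Submodule.baseChange_bot, Submodule.map_bot]
  · have h1 := h ⟨g, hg⟩
    rwa [piece_one, Equiv.Perm.one_apply, piece_one] at h1

variable (K : Type u) [Field K] [Algebra F K]

/-- Over a field the spectrum is a point, so a `K`-point of the automorphism group scheme induces a
single permutation of the support. -/
theorem permutes_one_of_locallyPermutes {φ : (K ⊗[F] A) ≃ₗ[K] (K ⊗[F] A)}
    (h : LocallyPermutes Γ.comp φ) (P : PrimeSpectrum K) :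
    Permutes Γ.comp φ (1 : K) (Γ.localPerm h P) := by
  obtain ⟨σ, e, he, hσ⟩ := Γ.exists_permutes h P
  rw [Γ.localPerm_eq h P he hσ]
  have he0 : e ≠ 0 := fun h0 => he (h0 ▸ P.asIdeal.zero_mem)
  simpa [he0] using hσ.mul_left e⁻¹

variable [IsScalarTower F A A] [SMulCommClass F A A]

theorem ker_toImage_autToSym :
    ((toImage Γ.autToSym).app (CommAlgCat.of F K)).hom.ker =
      (Γ.stabScheme.obj (CommAlgCat.of F K)).subgroupOf
        (Γ.autScheme.obj (CommAlgCat.of F K)) := by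
  ext φ
  have hker : φ ∈ ((toImage Γ.autToSym).app (CommAlgCat.of F K)).hom.ker ↔
      Γ.localPerm (R := K) φ.2.2 = 1 := MonoidHom.mem_ker.trans Subtype.ext_iff
  refine hker.trans ⟨?_, ?_⟩
  · intro h
    refine ⟨φ.2.1, (Γ.stabilizes_iff_permutes_one _).2 ?_⟩
    have h1 := Γ.permutes_one_of_locallyPermutes K φ.2.2 ⊥
    rwa [h] at h1
  · intro h
    refine LocallyConstant.ext fun P => ?_
    exact Γ.localPerm_eq _ P ((Ideal.ne_top_iff_one _).1 P.2.ne_top)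
      ((Γ.stabilizes_iff_permutes_one _).1 h.2)

variable [FiniteDimensional F A]

theorem permutes_weylPermBaseChange (φ : (Γ.baseChange K).autGroup) :
    Permutes Γ.comp φ.1 (1 : K) (Γ.weylPermBaseChange K (φ : (Γ.baseChange K).WeylGroup)) := by
  intro s
  rw [piece_one, piece_one]
  exact (Γ.baseChange K).permHom_spec φ
    ((Equiv.setCongr (Γ.supp_baseChange K)).symm s)

theorem weylPermBaseChange_injective : Function.Injective (Γ.weylPermBaseChange K) :=
  (Equiv.permCongrHom (Equiv.setCongr (Γ.supp_baseChange K))).injective.comp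
    (Γ.baseChange K).weylPerm_injective

/-- The permutations of the support that come from the Weyl group of `Γ_K` are those induced by
the `K`-points of the automorphism group scheme of `Γ`. -/
theorem mem_range_weylPermBaseChange_iff {σ : Equiv.Perm Γ.supp} :
    σ ∈ (Γ.weylPermBaseChange K).range ↔
      ∃ φ ∈ algebraAut K (K ⊗[F] A), Permutes Γ.comp φ (1 : K) σ := by
  constructor
  · rintro ⟨w, rfl⟩
    induction w using QuotientGroup.induction_on with
    | H φ => exact ⟨φ.1, φ.2.1, Γ.permutes_weylPermBaseChange K φ⟩
  · rintro ⟨φ, hφ, h⟩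
    have hle : ∀ g, ∃ g', ((Γ.baseChange K).comp g).map φ.toLinearMap ≤
        (Γ.baseChange K).comp g' := by
      intro g
      by_cases hg : Γ.comp g = ⊥
      · refine ⟨g, ?_⟩
        change ((Γ.comp g).baseChange K).map _ ≤ _
        rw [hg, Submodule.baseChange_bot, Submodule.map_bot]
        exact bot_le
      · have h1 := h ⟨g, hg⟩
        rw [piece_one, piece_one] at h1
        exact ⟨_, h1.le⟩
    -- two permutations induced by the same `K`-point are equal
    let ψ : (Γ.baseChange K).autGroup := ⟨φ, hφ, hle⟩
    have hone : (1 : K) ∉ (⊥ : PrimeSpectrum K).asIdeal :=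
      (Ideal.ne_top_iff_one _).1 (⊥ : PrimeSpectrum K).2.ne_top
    exact ⟨(ψ : (Γ.baseChange K).WeylGroup),
      Γ.permutes_unique ⊥ hone hone (Γ.permutes_weylPermBaseChange K ψ) h⟩

/-- Every permutation that an automorphism of `R ⊗ A` induces on the part of `R ⊗ A` cut out by a
nonzero idempotent `e` comes from the Weyl group of `Γ_K`. The automorphism and `e` are defined
over a finitely generated subalgebra of `R`, and the Nullstellensatz yields a homomorphism from it
to `K` that maps `e` to `1`. -/
theorem mem_range_weylPermBaseChange_of_permutes [IsAlgClosed K] {R : Type u} [CommRing R]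
    [Algebra F R] {φ : (R ⊗[F] A) ≃ₗ[R] (R ⊗[F] A)} (hφ : φ ∈ algebraAut R (R ⊗[F] A))
    {e : R} (he : IsIdempotentElem e) (he0 : e ≠ 0) {σ : Equiv.Perm Γ.supp}
    (h : Permutes Γ.comp φ e σ) : σ ∈ (Γ.weylPermBaseChange K).range := by
  obtain ⟨R₀, hfg, heR₀, φ₀, rfl⟩ := exists_fg_glMap_eq φ e
  have hinj : Function.Injective R₀.val := Subtype.val_injective
  have he' : IsIdempotentElem (⟨e, heR₀⟩ : R₀) := Subtype.ext he
  have : Algebra.FiniteType F R₀ := R₀.fg_iff_finiteType.1 hfg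
  obtain ⟨f, hf⟩ := exists_algHom_ne_zero (F := F) K (e := (⟨e, heR₀⟩ : R₀)) fun hnil =>
    he0 (congrArg Subtype.val (he'.eq_zero_of_isNilpotent hnil))
  have hf1 : f ⟨e, heR₀⟩ = 1 :=
    (IsIdempotentElem.iff_eq_zero_or_one.1 (he'.map f)).resolve_left hf
  refine (Γ.mem_range_weylPermBaseChange_iff K).2
    ⟨glMap f φ₀, glMap_mul f (mem_algebraAut_of_glMap hinj hφ), ?_⟩
  rw [← hf1]
  exact (permutes_of_glMap hinj he' h).glMap f

/-- The Weyl group scheme is the constant group scheme of the Weyl group of `Γ_K`, both regarded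
inside the constant group scheme of permutations of the support. -/
theorem weylScheme_obj [IsAlgClosed K] (R : CommAlgCat.{u} F) :
    Γ.weylScheme.obj R = (constantSubgroupFunctor F (Γ.weylPermBaseChange K).range).obj R := by
  have : Nontrivial (CommAlgCat.of F K) := inferInstanceAs (Nontrivial K)
  refine image_obj_eq_constantSubgroupFunctor Γ.autToSym _ ?_ (CommAlgCat.of F K) ?_ R
  · intro S φ P
    obtain ⟨n, e, σ, he, -, h⟩ := φ.2.2
    obtain ⟨i, hi⟩ : ∃ i, e i ∉ P.asIdeal := by
      by_contra! hcon
      refine P.2.ne_top ((Ideal.eq_top_iff_one _).2 ?_)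
      rw [← he.complete]
      exact sum_mem fun i _ => hcon i
    change Γ.localPerm (R := S) φ.2.2 P ∈ _
    rw [Γ.localPerm_eq φ.2.2 P hi (h i)]
    exact Γ.mem_range_weylPermBaseChange_of_permutes K φ.2.1 (he.idem i)
      (fun h0 => hi (h0 ▸ P.asIdeal.zero_mem)) (h i)
  · intro σ hσ
    obtain ⟨φ, hφ, h⟩ := (Γ.mem_range_weylPermBaseChange_iff K).1 hσ
    refine ⟨⟨φ, hφ, LocallyPermutes.of_permutes_one h⟩, LocallyConstant.ext fun P => ?_⟩
    exact Γ.localPerm_eq (LocallyPermutes.of_permutes_one h) P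
      ((Ideal.ne_top_iff_one _).1 P.2.ne_top) h

theorem toImage_autToSym_surjective [IsAlgClosed K] :
    Function.Surjective ((toImage Γ.autToSym).app (CommAlgCat.of F K)).hom := by
  rintro ⟨c, hc⟩
  change LocallyConstant (PrimeSpectrum K) (Equiv.Perm Γ.supp) at c
  have hc' := hc
  change _ ∈ Γ.weylScheme.obj _ at hc'
  rw [Γ.weylScheme_obj K] at hc'
  obtain ⟨φ, hφ, h⟩ := (Γ.mem_range_weylPermBaseChange_iff K).1 (hc' ⊥)
  refine ⟨⟨φ, hφ, LocallyPermutes.of_permutes_one h⟩, Subtype.ext (LocallyConstant.ext fun P => ?_)⟩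
  have hP : P = (⊥ : PrimeSpectrum K) := Subsingleton.elim (α := PrimeSpectrum K) _ _
  subst hP
  exact Γ.localPerm_eq (LocallyPermutes.of_permutes_one h) _
    ((Ideal.ne_top_iff_one _).1 (⊥ : PrimeSpectrum K).2.ne_top) h

end AlgebraGrading

end GradingScheme

theorem proposition3p2 {F A G : Type u} [Field F] [NonUnitalNonAssocRing A] [Module F A]
    [IsScalarTower F A A] [SMulCommClass F A A] [FiniteDimensional F A] [CommGroup G]
    (Γ : GradingScheme.AlgebraGrading F A G)
    (K : Type u) [Field K] [Algebra F K] [IsAlgClosure F K] :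
    -- the Weyl group scheme of `Γ`, inside the constant group scheme `Sym(supp Γ)`, is isomorphic
    -- to the constant group scheme of the Weyl group of `Γ_K`, inside `Sym(supp Γ)` as well
    (∃ e : Γ.weylScheme.toFunctor ≅
        GradingScheme.constantGroupScheme F (Γ.baseChange K).WeylGroup,
      e.hom ≫ GradingScheme.constantGroupSchemeMap F (Γ.weylPermBaseChange K) =
        Γ.weylScheme.ι) ∧
    -- exactness of `1 → Stab(Γ)(K) → Aut(Γ)(K) → W(Γ)(K) → 1`
    ((GradingScheme.toImage Γ.autToSym).app (CommAlgCat.of F K)).hom.ker =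
      (Γ.stabScheme.obj (CommAlgCat.of F K)).subgroupOf (Γ.autScheme.obj (CommAlgCat.of F K)) ∧
    Function.Surjective ((GradingScheme.toImage Γ.autToSym).app (CommAlgCat.of F K)).hom := by
  have : IsAlgClosed K := IsAlgClosure.isAlgClosed F
  exact ⟨GradingScheme.exists_iso_constantGroupScheme _ (Γ.weylPermBaseChange_injective K) _
    (Γ.weylScheme_obj K), Γ.ker_toImage_autToSym K, Γ.toImage_autToSym_surjective K⟩
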